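/- Let $k$ be an algebraic closure of a finite field, and let $U$ and $V$ be smooth affine connected schemes of finite type over $k$. Let $\eta\colon \operatorname{Spec}\Omega\to U\times_k V$ be a geometric point (with $\Omega$ a separably closed field), and let $\eta'$ and $\eta''$ be its images in $U$ and $V$ under the two projections $p_U\colon U\times_k V\to U$ and $p_V\colon U\times_k V\to V$. For a scheme $X$ with a geometric point $x$, let $\pi_1(X,x)$ denote the étale fundamental group, that is, the automorphism group of the fibre functor $Y\mapsto \operatorname{Hom}_X(x,Y)$ on the category of finite étale $X$-schemes. Then the natural homomorphism $$(p_{U,*},p_{V,*})\colon \pi_1(U\times_k V,\eta)\longrightarrow \pi_1(U,\eta')\times\pi_1(V,\eta'')$$ is surjective. -/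

import Mathlib

open CategoryTheory CategoryTheory.Limits AlgebraicGeometry

universe u

noncomputable section

namespace EtalePi

/-- The property of a morphism of schemes of being finite étale. -/
abbrev finiteEtale : MorphismProperty Scheme.{u} := @IsFinite ⊓ @Etale

instance : finiteEtale.{u}.IsStableUnderBaseChange :=
  MorphismProperty.IsStableUnderBaseChange.inf

/-- The category of finite étale schemes over `X` (finite étale coverings of `X`), with all
`X`-morphisms between them. -/
abbrev FEt (X : Scheme.{u}) : Type (u + 1) := finiteEtale.{u}.Over ⊤ X

/-- The geometric points of the `X`-scheme `p : Y ⟶ X` lying over `x : Spec Ω ⟶ X`. -/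
abbrev Fibre {X Y : Scheme.{u}} (p : Y ⟶ X) {Ω : Type u} [Field Ω]
    (x : Spec (.of Ω) ⟶ X) : Type u :=
  { y : Spec (.of Ω) ⟶ Y // y ≫ p = x }

/-- A finite morphism has finite geometric fibres. -/
instance finite_fibre {X Y : Scheme.{u}} (p : Y ⟶ X) [IsFinite p] {Ω : Type u} [Field Ω]
    (x : Spec (.of Ω) ⟶ X) : Finite (Fibre p x) := by
  let q := pullback.snd p x
  have hq : q.appTop.hom.Finite := q.finite_appTop
  have : IsAffine (pullback p x) := isAffine_of_isAffineHom q
  have hK : IsField Γ(Spec (.of Ω), ⊤) :=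
    (Scheme.ΓSpecIso (.of Ω)).commRingCatIsoToRingEquiv.toMulEquiv.isField (Field.toIsField Ω)
  let _ : Field Γ(Spec (.of Ω), ⊤) := hK.toField
  let _ : Algebra Γ(Spec (.of Ω), ⊤) Γ(pullback p x, ⊤) := q.appTop.hom.toAlgebra
  have : Module.Finite Γ(Spec (.of Ω), ⊤) Γ(pullback p x, ⊤) := hq
  let s (y : Fibre p x) : Spec (.of Ω) ⟶ pullback p x :=
    pullback.lift y.1 (𝟙 _) (y.2.trans (Category.id_comp x).symm)
  have hs (y : Fibre p x) : q.appTop ≫ (s y).appTop = 𝟙 _ := by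
    have h : s y ≫ q = 𝟙 _ := pullback.lift_snd _ _ _
    rw [← Scheme.Hom.comp_appTop, h, Scheme.Hom.id_appTop]
  let φ (y : Fibre p x) : Γ(pullback p x, ⊤) →ₐ[Γ(Spec (.of Ω), ⊤)] Γ(Spec (.of Ω), ⊤) :=
    { (s y).appTop.hom with
      commutes' := fun r ↦ congr($(hs y) r) }
  refine Finite.of_injective φ fun y z h ↦ ?_
  have h1 : (s y).appTop = (s z).appTop := by
    ext a
    exact DFunLike.congr_fun h a
  have h2 : s y = s z := ext_of_isAffine h1
  have hf (y : Fibre p x) : s y ≫ pullback.fst p x = y.1 := pullback.lift_fst _ _ _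
  exact Subtype.ext (by rw [← hf y, ← hf z, h2])

instance {X : Scheme.{u}} (Y : FEt X) : IsFinite Y.hom := Y.prop.1

instance {X : Scheme.{u}} (Y : FEt X) : Etale Y.hom := Y.prop.2

/-- The fibre functor at a geometric point `x : Spec Ω ⟶ X`: a finite étale `Y ⟶ X` is sent to
the finite set of geometric points of `Y` over `x`. -/
@[simps]
def fibre {X : Scheme.{u}} {Ω : Type u} [Field Ω] (x : Spec (.of Ω) ⟶ X) :
    FEt X ⥤ FintypeCat.{u} where
  obj Y := .of (Fibre Y.hom x)
  map f := FintypeCat.homMk fun y ↦ ⟨y.1 ≫ f.left, by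
    rw [Category.assoc]
    exact (congr(y.1 ≫ $(MorphismProperty.Over.w f))).trans y.2⟩

/-- The étale fundamental group `π₁(X, x)`: the automorphism group of the fibre functor. -/
abbrev Pi1 {X : Scheme.{u}} {Ω : Type u} [Field Ω] (x : Spec (.of Ω) ⟶ X) : Type (u + 1) :=
  Aut (fibre x)

/-- Pullback of finite étale coverings along `f`. -/
abbrev pullbackFEt {X' X : Scheme.{u}} (f : X' ⟶ X) : FEt X ⥤ FEt X' :=
  MorphismProperty.Over.pullback finiteEtale ⊤ f

/-- The geometric points of `Y ×_X X'` over `x'` are those of `Y` over the image `x' ≫ f`. -/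
@[simps]
def fibrePullbackEquiv {X' X Y : Scheme.{u}} (p : Y ⟶ X) (f : X' ⟶ X) {Ω : Type u} [Field Ω]
    (x' : Spec (.of Ω) ⟶ X') : Fibre (pullback.snd p f) x' ≃ Fibre p (x' ≫ f) where
  toFun y := ⟨y.1 ≫ pullback.fst p f, by
    rw [Category.assoc, pullback.condition, ← Category.assoc, y.2]⟩
  invFun y := ⟨pullback.lift y.1 x' y.2, pullback.lift_snd _ _ _⟩
  left_inv y := by
    apply Subtype.ext
    apply pullback.hom_ext
    · exact pullback.lift_fst _ _ _
    · exact (pullback.lift_snd _ _ _).trans y.2.symm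
  right_inv y := Subtype.ext (pullback.lift_fst _ _ _)

/-- The fibre functor at the image of `x'` under `f` is the pullback functor followed by the fibre
functor at `x'`. -/
def fibrePullbackIso {X' X : Scheme.{u}} (f : X' ⟶ X) {Ω : Type u} [Field Ω]
    (x' : Spec (.of Ω) ⟶ X') : pullbackFEt f ⋙ fibre x' ≅ fibre (x' ≫ f) :=
  NatIso.ofComponents
    (fun Y ↦ FintypeCat.equivEquivIso (fibrePullbackEquiv Y.hom f x'))
    (fun {Y Z} g ↦ by
      ext y
      apply Subtype.ext
      have h : ((pullbackFEt f).map g).left ≫ pullback.fst Z.hom f =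
          pullback.fst Y.hom f ≫ g.left := pullback.lift_fst _ _ _
      exact (Category.assoc _ _ _).trans
        ((congrArg (y.1 ≫ ·) h).trans (Category.assoc _ _ _).symm))

/-- The homomorphism `f_* : π₁(X', x') → π₁(X, f(x'))` induced by `f : X' ⟶ X`: an automorphism of
the fibre functor at `x'` acts on the fibre of `Y` at `f(x')`, which is the fibre at `x'` of the
pullback of `Y` along `f`. -/
def Pi1.map {X' X : Scheme.{u}} (f : X' ⟶ X) {Ω : Type u} [Field Ω]
    (x' : Spec (.of Ω) ⟶ X') : Pi1 x' →* Pi1 (x' ≫ f) :=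
  (fibrePullbackIso f x').conjAut.toMonoidHom.comp
    (((Functor.whiskeringLeft _ _ FintypeCat.{u}).obj (pullbackFEt f)).mapAut (fibre x'))

end EtalePi

end

/-!
A connected finite étale covering of a locally Noetherian scheme has a transitive action of `π₁` on
its geometric fibre: any finite diagram of coverings is dominated by a connected pointed covering
`(P, p)`, a morphism out of `P` is determined by the image of one geometric point, so that moving
`p` to another point `p'` permutes the fibres of the diagram compatibly, and compactness turns these
permutations into an automorphism of the fibre functor.

Given `σ ∈ π₁(U)` and `τ ∈ π₁(V)`, choose connected pointed coverings `(A, a)` of `U` and `(B, b)`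
of `V` which determine the actions of `σ` and `τ` on finitely many prescribed coverings. A connected
scheme locally of finite type over a separably closed field is geometrically connected, so `A ×ₖ B`
is a connected covering of `U ×ₖ V`. By transitivity some `α ∈ π₁(U ×ₖ V)` moves `(a, b)` to
`(σ a, τ b)`; its images then agree with `σ` and `τ` on the prescribed coverings. Compactness of
`π₁(U ×ₖ V)` yields a single `α` for all coverings.
-/

universe v w

namespace EtalePi

section LocallyConnected

open TopologicalSpace

theorem finite_of_noetherianSpace_of_totallyDisconnectedSpace (α : Type*) [TopologicalSpace α]
    [NoetherianSpace α] [TotallyDisconnectedSpace α] : Finite α := by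
  have hfin : (⋃₀ irreducibleComponents α).Finite :=
    NoetherianSpace.finite_irreducibleComponents.sUnion fun Z hZ ↦
      hZ.prop.isPreirreducible.isPreconnected.subsingleton.finite
  rw [sUnion_irreducibleComponents] at hfin
  exact Set.finite_univ_iff.mp hfin

theorem isOpen_connectedComponent_of_noetherianSpace {α : Type*} [TopologicalSpace α]
    [NoetherianSpace α] (x : α) : IsOpen (connectedComponent x) := by
  have : NoetherianSpace (ConnectedComponents α) :=
    noetherianSpace_of_surjective _ ConnectedComponents.continuous_coe
      ConnectedComponents.surjective_coe
  have : Finite (ConnectedComponents α) :=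
    finite_of_noetherianSpace_of_totallyDisconnectedSpace _
  rw [← connectedComponents_preimage_singleton]
  exact (isOpen_discrete _).preimage ConnectedComponents.continuous_coe

instance locallyConnectedSpace_of_isLocallyNoetherian {X : Scheme.{u}} [IsLocallyNoetherian X] :
    LocallyConnectedSpace X := by
  refine locallyConnectedSpace_iff_connected_subsets.mpr fun x N hN ↦ ?_
  obtain ⟨W, hW, hxW, hWN⟩ := exists_isAffineOpen_mem_and_subset
    (U := ⟨interior N, isOpen_interior⟩) (mem_interior_iff_mem_nhds.mpr hN)
  have : IsNoetherianRing Γ(X, W) := IsLocallyNoetherian.component_noetherian ⟨W, hW⟩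
  have : NoetherianSpace W := noetherianSpace_of_isAffineOpen W hW
  refine ⟨connectedComponentIn W x, ?_, isPreconnected_connectedComponentIn,
    (connectedComponentIn_subset _ _).trans (hWN.trans interior_subset)⟩
  refine IsOpen.mem_nhds ?_ (mem_connectedComponentIn hxW)
  rw [connectedComponentIn_eq_image hxW]
  exact W.isOpen.isOpenMap_subtype_val _ (isOpen_connectedComponent_of_noetherianSpace (α := W) _)

end LocallyConnected

section GeometricallyConnected

theorem connectedSpace_of_isOpenMap_of_isPreconnected_preimage {X Y : Type*} [TopologicalSpace X]
    [TopologicalSpace Y] [ConnectedSpace Y] {f : X → Y} (hf : IsOpenMap f)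
    (hsurj : Function.Surjective f) {D : Set Y} (hD : Dense D)
    (hpre : ∀ y ∈ D, IsPreconnected (f ⁻¹' {y})) : ConnectedSpace X := by
  have : Nonempty X := hsurj.nonempty
  suffices PreconnectedSpace X from ConnectedSpace.mk ‹_›
  refine preconnectedSpace_iff_clopen.mpr fun Z hZ ↦ ?_
  by_contra! h
  obtain ⟨hne, hne'⟩ := h
  have hcover : f '' Z ∪ f '' Zᶜ = Set.univ := by
    rw [← Set.image_union, Set.union_compl_self, Set.image_univ_of_surjective hsurj]
  have hmeet : (f '' Z ∩ f '' Zᶜ).Nonempty :=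
    nonempty_inter (hf _ hZ.isOpen) (hf _ hZ.compl.isOpen) hcover (hne.image f)
      ((Set.nonempty_compl.mpr hne').image f)
  obtain ⟨y, ⟨⟨z, hz, hzy⟩, z', hz', hz'y⟩, hyD⟩ :=
    hD.inter_open_nonempty _ ((hf _ hZ.isOpen).inter (hf _ hZ.compl.isOpen)) hmeet
  exact hz' ((hpre y hyD).subset_isClopen hZ ⟨z, hzy, hz⟩ hz'y)

theorem universallyInjective_of_isIntegralHom_of_isSepClosed {k L : Type u} [Field k]
    [IsSepClosed k] [Field L] (h : Spec (.of L) ⟶ Spec (.of k)) [IsIntegralHom h] :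
    UniversallyInjective h := by
  obtain ⟨φ, rfl⟩ := Spec.map_surjective h
  let := φ.hom.toAlgebra
  have : Algebra.IsIntegral k L := ⟨(IsIntegralHom.SpecMap_iff (φ := φ)).mp ‹_›⟩
  refine ((tfae_universallyInjective (Spec.map φ)).out 0 1).mpr
    fun (K : Type u) [Field K] a b hab ↦ ?_
  obtain ⟨ψ, rfl⟩ := Spec.map_surjective a
  obtain ⟨ψ', rfl⟩ := Spec.map_surjective b
  have hψ : φ ≫ ψ = φ ≫ ψ' := Spec.map_injective (by simpa only [Spec.map_comp] using hab)
  congr 1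
  ext1
  have := IsPurelyInseparable.injective_comp_algebraMap k L K
  exact this (congrArg CommRingCat.Hom.hom hψ)

variable {k : Type u} [Field k] [IsSepClosed k] {X : Scheme.{u}} (f : X ⟶ Spec (.of k))
  [LocallyOfFiniteType f]

theorem subsingleton_preimage_pullback_fst {T : Scheme.{u}} [Subsingleton T]
    (t : T ⟶ Spec (.of k)) {x : X} (hx : IsClosed {x}) :
    (pullback.fst f t ⁻¹' {x}).Subsingleton := by
  let i := X.fromSpecResidueField x
  have : IsClosedImmersion i := isClosed_singleton_iff_isClosedImmersion.mp hx
  have : IsFinite (i ≫ f) :=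
    isFinite_iff_locallyOfFiniteType_of_jacobsonSpace.mpr inferInstance
  have : UniversallyInjective (i ≫ f) :=
    universallyInjective_of_isIntegralHom_of_isSepClosed (L := X.residueField x) _
  have hinj : Function.Injective (pullback.snd (i ≫ f) t) :=
    UniversallyInjective.universally_injective _ _ _ (IsPullback.of_hasPullback (i ≫ f) t).flip
  have : Subsingleton ↥(pullback (i ≫ f) t) := hinj.subsingleton
  have hrange := Scheme.Pullback.range_map (i ≫ f) t f t i (𝟙 T) (𝟙 _) (by simp) (by simp)
  have hi : Set.range i = {x} := Scheme.range_fromSpecResidueField x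
  simp only [hi, Scheme.Hom.id_base, TopCat.hom_id, ContinuousMap.coe_id, Set.range_id,
    Set.preimage_univ, Set.inter_univ] at hrange
  rw [← hrange]
  exact Set.subsingleton_range _

theorem geometricallyConnected_of_isSepClosed [ConnectedSpace X] : GeometricallyConnected f := by
  have : JacobsonSpace X := LocallyOfFiniteType.jacobsonSpace f
  refine ⟨geometrically_iff_of_isClosedUnderIsomorphisms.mpr fun K _ y ↦ ?_⟩
  refine connectedSpace_of_isOpenMap_of_isPreconnected_preimage (pullback.fst f y).isOpenMap
    (pullback.fst f y).surjective (dense_iff_closure_eq.mpr closure_closedPoints) fun x hx ↦ ?_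
  exact (subsingleton_preimage_pullback_fst f y hx).isPreconnected

end GeometricallyConnected

section ConnectedSchemes

theorem surjective_of_universallyClosed_of_universallyOpen {P Q : Scheme.{u}} (f : P ⟶ Q)
    [UniversallyClosed f] [UniversallyOpen f] [Nonempty P] [PreconnectedSpace Q] :
    Surjective f :=
  ⟨Set.range_eq_univ.mp <|
    IsClopen.eq_univ ⟨f.isClosedMap.isClosed_range, f.isOpenMap.isOpen_range⟩
      (Set.range_nonempty f)⟩

theorem exists_comp_eq_of_etale_of_universallyClosed {P Q : Scheme.{u}} (f : P ⟶ Q)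
    [UniversallyClosed f] [Etale f] [Nonempty P] [PreconnectedSpace Q] {Ω : Type u} [Field Ω]
    [IsSepClosed Ω] (q : Spec (.of Ω) ⟶ Q) : ∃ p : Spec (.of Ω) ⟶ P, p ≫ f = q := by
  have := surjective_of_universallyClosed_of_universallyOpen f
  obtain ⟨x, hx⟩ := f.surjective (q default)
  obtain ⟨p, hp, -⟩ := Scheme.exists_fac_of_etale_of_isSepClosed f q x hx
  exact ⟨p, hp⟩

theorem eq_of_comp_eq_of_preconnectedSpace {X P W T : Scheme.{u}} (q : W ⟶ X)
    [FormallyUnramified q] [LocallyOfFiniteType q] [IsSeparated q] [PreconnectedSpace P]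
    [Nonempty T] {f g : P ⟶ W} (h : f ≫ q = g ≫ q) (t : T ⟶ P) (ht : t ≫ f = t ≫ g) :
    f = g := by
  let d := pullback.lift f g h
  have hdf : d ≫ pullback.fst q q = f := pullback.lift_fst _ _ _
  have hdg : d ≫ pullback.snd q q = g := pullback.lift_snd _ _ _
  -- `i` is the locus where `f` and `g` agree, closed and open as the diagonal of `q` is.
  let i := pullback.snd (pullback.diagonal q) d
  have hi : i ≫ d = pullback.fst _ _ ≫ pullback.diagonal q := pullback.condition.symm
  have hfg : i ≫ f = i ≫ g := by
    rw [← hdf, ← hdg, reassoc_of% hi, reassoc_of% hi, pullback.diagonal_fst,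
      pullback.diagonal_snd]
  have htd : (t ≫ f) ≫ pullback.diagonal q = t ≫ d := by
    apply pullback.hom_ext
    · simp only [Category.assoc, pullback.diagonal_fst, hdf, Category.comp_id]
    · simp only [Category.assoc, pullback.diagonal_snd, hdg, Category.comp_id, ht]
  have : Nonempty ↥(pullback (pullback.diagonal q) d) :=
    .map (pullback.lift (t ≫ f) t htd) inferInstance
  have : Surjective i := surjective_of_universallyClosed_of_universallyOpen i
  have : IsIso i :=
    (isIso_iff_isOpenImmersion_and_surjective i).mpr ⟨inferInstance, inferInstance⟩
  exact (cancel_epi i).mp hfg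

theorem exists_connectedSpace_fac {S T : Scheme.{u}} [ConnectedSpace S] [LocallyConnectedSpace T]
    (t : S ⟶ T) :
    ∃ (P : Scheme.{u}) (i : P ⟶ T) (p : S ⟶ P), IsClosedImmersion i ∧
      IsOpenImmersion i ∧ ConnectedSpace P ∧ p ≫ i = t := by
  obtain ⟨s⟩ : Nonempty S := inferInstance
  let C : T.Opens := ⟨connectedComponent (t s), isOpen_connectedComponent⟩
  have hC : Set.range C.ι = connectedComponent (t s) := Scheme.Opens.range_ι C
  have ht : Set.range t ⊆ Set.range C.ι := hC ▸
    (isPreconnected_range t.continuous).subset_connectedComponent (Set.mem_range_self s)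
  exact ⟨C, C.ι, IsOpenImmersion.lift C.ι t ht,
    .of_isPreimmersion _ (hC ▸ isClosed_connectedComponent), inferInstance,
    isConnected_iff_connectedSpace.mp isConnected_connectedComponent,
    IsOpenImmersion.lift_fac _ _ _⟩

end ConnectedSchemes

section FintypeFunctor

open PreGaloisCategory

variable {C : Type v} [Category.{w} C] {F : C ⥤ FintypeCat.{u}}

theorem exists_aut_app_eq_of_forall_finset {Q : C} (q q' : F.obj Q)
    (H : ∀ S : Finset (Arrow C), ∃ g : ∀ W, Aut (F.obj W), (g Q).hom q = q' ∧
      ∀ a ∈ S, F.map a.hom ≫ (g a.right).hom = (g a.left).hom ≫ F.map a.hom) :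
    ∃ α : Aut F, α.hom.app Q q = q' := by
  let K (a : Arrow C) : Set (∀ W, Aut (F.obj W)) := {g | (g Q).hom q = q' ∧
    F.map a.hom ≫ (g a.right).hom = (g a.left).hom ≫ F.map a.hom}
  have hK (a) : IsClosed (K a) :=
    .inter (isClosed_eq (by fun_prop) (by fun_prop)) (isClosed_eq (by fun_prop) (by fun_prop))
  obtain ⟨g, hg⟩ := CompactSpace.iInter_nonempty hK fun S ↦ by
    obtain ⟨g, hgq, hgS⟩ := H S
    exact ⟨g, Set.mem_iInter₂.mpr fun a ha ↦ ⟨hgq, hgS a ha⟩⟩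
  rw [Set.mem_iInter] at hg
  obtain ⟨α, rfl⟩ : g ∈ Set.range (autEmbedding F) := by
    rw [autEmbedding_range]
    exact Set.mem_iInter.mpr fun a ↦ (hg a).2
  exact ⟨α, (hg (Arrow.mk (𝟙 Q))).1⟩

theorem exists_aut_hom_map_eq {P W : C} {p p' : F.obj P}
    (hp : Function.Bijective fun h : P ⟶ W ↦ F.map h p)
    (hp' : Function.Injective fun h : P ⟶ W ↦ F.map h p') :
    ∃ g : Aut (F.obj W), ∀ h : P ⟶ W, g.hom (F.map h p) = F.map h p' := by
  let e := Equiv.ofBijective _ hp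
  have : Finite (P ⟶ W) := Finite.of_equiv _ e.symm
  have hinj : Function.Injective fun w ↦ F.map (e.symm w) p' := hp'.comp e.symm.injective
  refine ⟨FintypeCat.equivEquivIso (Equiv.ofBijective _ (Finite.injective_iff_bijective.mp hinj)),
    fun h ↦ ?_⟩
  exact congrArg (F.map · p') (e.symm_apply_apply h)

theorem exists_natural_aut_of_bijective {P : C} {p p' : F.obj P} {S : Set C}
    (hp : ∀ W ∈ S, Function.Bijective fun h : P ⟶ W ↦ F.map h p)
    (hp' : ∀ W ∈ S, Function.Injective fun h : P ⟶ W ↦ F.map h p') :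
    ∃ g : ∀ W, Aut (F.obj W), (∀ W ∈ S, ∀ h : P ⟶ W, (g W).hom (F.map h p) = F.map h p') ∧
      ∀ W ∈ S, ∀ W' ∈ S, ∀ h : W ⟶ W', F.map h ≫ (g W').hom = (g W).hom ≫ F.map h := by
  have (W : C) : ∃ g : Aut (F.obj W), W ∈ S →
      ∀ h : P ⟶ W, g.hom (F.map h p) = F.map h p' := by
    by_cases hW : W ∈ S
    · obtain ⟨g, hg⟩ := exists_aut_hom_map_eq (hp W hW) (hp' W hW)
      exact ⟨g, fun _ ↦ hg⟩
    · exact ⟨1, fun h ↦ absurd h hW⟩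
  choose g hg using this
  refine ⟨g, hg, fun W hW W' hW' h ↦ ?_⟩
  ext w
  obtain ⟨n, rfl⟩ := (hp W hW).surjective w
  have hn (r : F.obj P) : F.map h (F.map n r) = F.map (n ≫ h) r := by
    rw [F.map_comp, FintypeCat.comp_apply]
  simp only [FintypeCat.comp_apply, hn, hg W hW, hg W' hW']

theorem app_eq_app_of_surjective {α β : Aut F} {A W : C} {a : F.obj A}
    (hW : Function.Surjective fun h : A ⟶ W ↦ F.map h a)
    (ha : α.hom.app A a = β.hom.app A a) : α.hom.app W = β.hom.app W := by
  ext w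
  obtain ⟨m, rfl⟩ := hW w
  simp only [FunctorToFintypeCat.naturality, ha]

end FintypeFunctor

section Coverings

variable {X : Scheme.{u}}

instance isFinite_left {P Q : FEt X} (h : P ⟶ Q) : IsFinite h.left := by
  have : IsFinite (h.left ≫ Q.hom) := by rw [MorphismProperty.Over.w h]; infer_instance
  exact .of_comp h.left Q.hom

instance etale_left {P Q : FEt X} (h : P ⟶ Q) : Etale h.left := by
  have : Etale (h.left ≫ Q.hom) := by rw [MorphismProperty.Over.w h]; infer_instance
  exact .of_comp h.left Q.hom

instance isLocallyNoetherian_left [IsLocallyNoetherian X] (W : FEt X) :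
    IsLocallyNoetherian W.left :=
  LocallyOfFiniteType.isLocallyNoetherian (Y := X) W.hom

variable {Ω : Type u} [Field Ω] {x : Spec (.of Ω) ⟶ X}

theorem fibre_map_surjective [IsSepClosed Ω] {P Q : FEt X} [Nonempty P.left]
    [PreconnectedSpace Q.left] (h : P ⟶ Q) : Function.Surjective ((fibre x).map h) := by
  intro (q : Fibre Q.hom x)
  obtain ⟨p, hp⟩ := exists_comp_eq_of_etale_of_universallyClosed h.left q.1
  refine ⟨⟨p, ?_⟩, Subtype.ext hp⟩
  rw [← MorphismProperty.Over.w h, reassoc_of% hp, q.2]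

theorem fibre_map_apply_injective {P W : FEt X} [PreconnectedSpace P.left]
    (p : (fibre x).obj P) : Function.Injective fun h : P ⟶ W ↦ (fibre x).map h p := by
  intro h h' hp
  ext
  exact eq_of_comp_eq_of_preconnectedSpace W.hom
    ((MorphismProperty.Over.w h).trans (MorphismProperty.Over.w h').symm) p.1
    (congrArg Subtype.val hp)

theorem exists_hom_hom_fibre_map_eq {A B : FEt X} (a : (fibre x).obj A) (b : (fibre x).obj B) :
    ∃ (T : FEt X) (t : (fibre x).obj T), (∃ h : T ⟶ A, (fibre x).map h t = a) ∧
      ∃ h : T ⟶ B, (fibre x).map h t = b := by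
  let l : Spec (.of Ω) ⟶ pullback A.hom B.hom := pullback.lift a.1 b.1 (a.2.trans b.2.symm)
  have hla : l ≫ pullback.fst A.hom B.hom = a.1 := pullback.lift_fst _ _ _
  have hlb : l ≫ pullback.snd A.hom B.hom = b.1 := pullback.lift_snd _ _ _
  let T : FEt X := .mk ⊤ (pullback.fst A.hom B.hom ≫ A.hom) ⟨inferInstance, inferInstance⟩
  exact ⟨T, ⟨l, (reassoc_of% hla) A.hom |>.trans a.2⟩,
    ⟨MorphismProperty.Over.homMk (pullback.fst A.hom B.hom) rfl, Subtype.ext hla⟩,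
    ⟨MorphismProperty.Over.homMk (pullback.snd A.hom B.hom) pullback.condition.symm,
      Subtype.ext hlb⟩⟩

theorem exists_forall_hom_fibre_map_eq {ι : Type*} [Finite ι] (W : ι → FEt X)
    (w : ∀ i, (fibre x).obj (W i)) :
    ∃ (T : FEt X) (t : (fibre x).obj T), ∀ i, ∃ h : T ⟶ W i, (fibre x).map h t = w i := by
  let r (a b : Σ A : FEt X, (fibre x).obj A) : Prop := ∃ h : b.1 ⟶ a.1, (fibre x).map h b.2 = a.2
  have : IsTrans _ r := ⟨fun _ _ _ ⟨h, hh⟩ ⟨h', hh'⟩ ↦ ⟨h' ≫ h, by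
    rw [Functor.map_comp, FintypeCat.comp_apply, hh', hh]⟩⟩
  have hr : Directed r id := fun a b ↦
    let ⟨T, t, ht⟩ := exists_hom_hom_fibre_map_eq a.2 b.2
    ⟨⟨T, t⟩, ht⟩
  have : Nonempty (Σ A : FEt X, (fibre x).obj A) :=
    ⟨.mk ⊤ (𝟙 X) ⟨inferInstance, inferInstance⟩, x, Category.comp_id _⟩
  obtain ⟨⟨T, t⟩, ht⟩ := hr.finite_le fun i ↦ ⟨W i, w i⟩
  exact ⟨T, t, ht⟩

theorem exists_connectedSpace_fibre_map_bijective [IsLocallyNoetherian X]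
    (x : Spec (.of Ω) ⟶ X) {S : Set (FEt X)} (hS : S.Finite) :
    ∃ (P : FEt X) (p : (fibre x).obj P), ConnectedSpace P.left ∧
      ∀ W ∈ S, Function.Bijective fun h : P ⟶ W ↦ (fibre x).map h p := by
  have := hS.to_subtype
  obtain ⟨T, t, ht⟩ := exists_forall_hom_fibre_map_eq (x := x)
    (fun a : Σ W : S, (fibre x).obj W ↦ a.1) fun a ↦ a.2
  obtain ⟨P₀, i, p₀, _, _, _, hp₀⟩ := exists_connectedSpace_fac (T := T.left) t.1
  let P : FEt X := .mk ⊤ (i ≫ T.hom) ⟨inferInstance, inferInstance⟩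
  let p : (fibre x).obj P := ⟨p₀, (reassoc_of% hp₀) T.hom |>.trans t.2⟩
  let j : P ⟶ T := MorphismProperty.Over.homMk i rfl
  have hj : (fibre x).map j p = t := Subtype.ext hp₀
  have : ConnectedSpace P.left := ‹_›
  refine ⟨P, p, this, fun W hW ↦ ⟨fibre_map_apply_injective p, fun w ↦ ?_⟩⟩
  obtain ⟨h, hh⟩ := ht ⟨⟨W, hW⟩, w⟩
  exact ⟨j ≫ h, by simp only [Functor.map_comp, FintypeCat.comp_apply, hj, hh]⟩

theorem Pi1.exists_app_eq [IsLocallyNoetherian X] [IsSepClosed Ω] {Q : FEt X}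
    [PreconnectedSpace Q.left] (q q' : (fibre x).obj Q) : ∃ α : Pi1 x, α.hom.app Q q = q' := by
  refine exists_aut_app_eq_of_forall_finset q q' fun S ↦ ?_
  let S' : Set (FEt X) := insert Q (⋃ a ∈ S, {a.left, a.right})
  have hS' : S'.Finite := (S.finite_toSet.biUnion fun _ _ ↦ Set.toFinite _).insert Q
  have hQ : Q ∈ S' := Set.mem_insert _ _
  obtain ⟨P, p, _, hp⟩ := exists_connectedSpace_fibre_map_bijective x hS'
  obtain ⟨m, rfl⟩ := (hp Q hQ).surjective q
  obtain ⟨p', rfl⟩ := fibre_map_surjective (x := x) m q'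
  obtain ⟨g, hgp, hg⟩ :=
    exists_natural_aut_of_bijective hp fun W _ ↦ fibre_map_apply_injective (W := W) p'
  refine ⟨g, hgp Q hQ m, fun a ha ↦ hg _ ?_ _ ?_ a.hom⟩
  · exact .inr (Set.mem_biUnion ha (.inl rfl))
  · exact .inr (Set.mem_biUnion ha (.inr rfl))

end Coverings

section Functoriality

open PreGaloisCategory

variable {X' X : Scheme.{u}} (f : X' ⟶ X) {Ω : Type u} [Field Ω] (x' : Spec (.of Ω) ⟶ X')

theorem Pi1.isClosed_setOf_map_app_eq (Y : FEt X)
    (s : (fibre (x' ≫ f)).obj Y ⟶ (fibre (x' ≫ f)).obj Y) :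
    IsClosed {α | (Pi1.map f x' α).hom.app Y = s} := by
  let e : (fibre x').obj ((pullbackFEt f).obj Y) ≃ (fibre (x' ≫ f)).obj Y :=
    fibrePullbackEquiv Y.hom f x'
  have hcont (y) : Continuous fun α : Pi1 x' ↦ e (α • e.symm y) :=
    (continuous_of_discreteTopology (f := e)).comp (by fun_prop)
  have : {α | (Pi1.map f x' α).hom.app Y = s} = ⋂ y, {α : Pi1 x' | e (α • e.symm y) = s y} := by
    ext α
    simp only [ConcreteCategory.hom_ext_iff, Set.mem_iInter]
    rfl
  exact this ▸ isClosed_iInter fun y ↦ isClosed_eq (hcont y) continuous_const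

variable {f x'}

theorem Pi1.map_app_eq_of_comp_eq (α : Pi1 x') {A : FEt X} {Q : FEt X'} (c : Q.left ⟶ A.left)
    (hc : c ≫ A.hom = Q.hom ≫ f) {q : (fibre x').obj Q} {a a' : (fibre (x' ≫ f)).obj A}
    (ha : q.1 ≫ c = a.1) (ha' : (α.hom.app Q q).1 ≫ c = a'.1) :
    (Pi1.map f x' α).hom.app A a = a' := by
  let m : Q ⟶ (pullbackFEt f).obj A :=
    MorphismProperty.Over.homMk (pullback.lift c Q.hom hc) (pullback.lift_snd _ _ _)
  let e : (fibre x').obj ((pullbackFEt f).obj A) ≃ (fibre (x' ≫ f)).obj A :=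
    fibrePullbackEquiv A.hom f x'
  have hm (r : (fibre x').obj Q) : (e ((fibre x').map m r)).1 = r.1 ≫ c :=
    (Category.assoc _ _ _).trans (congrArg (r.1 ≫ ·) (pullback.lift_fst _ _ _))
  have hmq : e ((fibre x').map m q) = a := Subtype.ext ((hm q).trans ha)
  have hmq' : e ((fibre x').map m (α.hom.app Q q)) = a' := Subtype.ext ((hm _).trans ha')
  calc (Pi1.map f x' α).hom.app A a = e (α.hom.app _ (e.symm a)) := rfl
    _ = e (α.hom.app _ ((fibre x').map m q)) := by rw [← hmq, e.symm_apply_apply]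
    _ = a' := by rw [FunctorToFintypeCat.naturality, hmq']

end Functoriality

section Product

instance : finiteEtale.{u}.IsStableUnderComposition :=
  ⟨fun _ _ ⟨_, _⟩ ⟨_, _⟩ ↦ ⟨inferInstance, inferInstance⟩⟩

variable {S U V : Scheme.{u}} (f : U ⟶ S) (g : V ⟶ S)

/-- The external product of a covering `A` of `U` and a covering `B` of `V`: the fibre product of
`A` and `B` over `S`, as a covering of the fibre product of `U` and `V` over `S`. -/
noncomputable def externalProd (A : FEt U) (B : FEt V) : FEt (pullback f g) :=
  .mk ⊤ (pullback.map (A.hom ≫ f) (B.hom ≫ g) f g A.hom B.hom (𝟙 S) (Category.comp_id _)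
    (Category.comp_id _)) (MorphismProperty.pullbackMap A.prop B.prop rfl rfl)

/-- The projection of the external product to `A`, lying over the projection to `U`. -/
noncomputable def externalProdFst (A : FEt U) (B : FEt V) : (externalProd f g A B).left ⟶ A.left :=
  pullback.fst _ _

/-- The projection of the external product to `B`, lying over the projection to `V`. -/
noncomputable def externalProdSnd (A : FEt U) (B : FEt V) : (externalProd f g A B).left ⟶ B.left :=
  pullback.snd _ _

theorem externalProdFst_comp (A : FEt U) (B : FEt V) :
    externalProdFst f g A B ≫ A.hom = (externalProd f g A B).hom ≫ pullback.fst f g :=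
  (pullback.lift_fst _ _ _).symm

theorem externalProdSnd_comp (A : FEt U) (B : FEt V) :
    externalProdSnd f g A B ≫ B.hom = (externalProd f g A B).hom ≫ pullback.snd f g :=
  (pullback.lift_snd _ _ _).symm

theorem exists_fibre_externalProd {Ω : Type u} [Field Ω] {η : Spec (.of Ω) ⟶ pullback f g}
    {A : FEt U} {B : FEt V} (a : (fibre (η ≫ pullback.fst f g)).obj A)
    (b : (fibre (η ≫ pullback.snd f g)).obj B) :
    ∃ q : (fibre η).obj (externalProd f g A B), q.1 ≫ externalProdFst f g A B = a.1 ∧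
      q.1 ≫ externalProdSnd f g A B = b.1 := by
  have hab : a.1 ≫ A.hom ≫ f = b.1 ≫ B.hom ≫ g := by
    rw [reassoc_of% a.2, reassoc_of% b.2, pullback.condition]
  let q : Spec (.of Ω) ⟶ (externalProd f g A B).left := pullback.lift a.1 b.1 hab
  have hqA : q ≫ externalProdFst f g A B = a.1 := pullback.lift_fst _ _ _
  have hqB : q ≫ externalProdSnd f g A B = b.1 := pullback.lift_snd _ _ _
  refine ⟨⟨q, pullback.hom_ext ?_ ?_⟩, hqA, hqB⟩
  · rw [Category.assoc, ← externalProdFst_comp, reassoc_of% hqA, a.2]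
  · rw [Category.assoc, ← externalProdSnd_comp, reassoc_of% hqB, b.2]

end Product

section SeparablyClosed

variable {k : Type u} [Field k] [IsSepClosed k] {U V : Scheme.{u}} (f : U ⟶ Spec (.of k))
  (g : V ⟶ Spec (.of k)) [LocallyOfFiniteType f]

theorem connectedSpace_externalProd {A : FEt U} {B : FEt V} [ConnectedSpace A.left]
    [ConnectedSpace B.left] : ConnectedSpace (externalProd f g A B).left := by
  let pA : A.left ⟶ U := A.hom
  let pB : B.left ⟶ V := B.hom
  have : Etale pA := A.prop.2
  have : Etale pB := B.prop.2
  have := geometricallyConnected_of_isSepClosed (pA ≫ f)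
  exact inferInstanceAs (ConnectedSpace ↥(pullback (pA ≫ f) (pB ≫ g)))

variable {f g} [IsLocallyNoetherian V] {Ω : Type u} [Field Ω] [IsSepClosed Ω]
  {η : Spec (.of Ω) ⟶ pullback f g}

theorem Pi1.exists_map_app_eq (σ : Pi1 (η ≫ pullback.fst f g)) (τ : Pi1 (η ≫ pullback.snd f g))
    {SU : Set (FEt U)} (hSU : SU.Finite) {SV : Set (FEt V)} (hSV : SV.Finite) :
    ∃ α : Pi1 η, (∀ Y ∈ SU, (Pi1.map (pullback.fst f g) η α).hom.app Y = σ.hom.app Y) ∧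
      ∀ Y ∈ SV, (Pi1.map (pullback.snd f g) η α).hom.app Y = τ.hom.app Y := by
  have := LocallyOfFiniteType.isLocallyNoetherian f
  have := LocallyOfFiniteType.isLocallyNoetherian (pullback.snd f g)
  obtain ⟨A, a, _, hA⟩ := exists_connectedSpace_fibre_map_bijective (η ≫ pullback.fst f g) hSU
  obtain ⟨B, b, _, hB⟩ := exists_connectedSpace_fibre_map_bijective (η ≫ pullback.snd f g) hSV
  have := connectedSpace_externalProd f g (A := A) (B := B)
  obtain ⟨q, hqA, hqB⟩ := exists_fibre_externalProd f g a b
  obtain ⟨q', hqA', hqB'⟩ := exists_fibre_externalProd f g (σ.hom.app A a) (τ.hom.app B b)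
  obtain ⟨α, rfl⟩ := Pi1.exists_app_eq q q'
  exact ⟨α,
    fun Y hY ↦ app_eq_app_of_surjective (hA Y hY).surjective
      (Pi1.map_app_eq_of_comp_eq α _ (externalProdFst_comp f g A B) hqA hqA'),
    fun Y hY ↦ app_eq_app_of_surjective (hB Y hY).surjective
      (Pi1.map_app_eq_of_comp_eq α _ (externalProdSnd_comp f g A B) hqB hqB')⟩

end SeparablyClosed

end EtalePi

open EtalePi in
theorem lemma5p1_general {k : Type u} [Field k] [IsSepClosed k] {U V : Scheme.{u}}
    (f : U ⟶ Spec (.of k)) (g : V ⟶ Spec (.of k)) [LocallyOfFiniteType f]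
    [IsLocallyNoetherian V] {Ω : Type u} [Field Ω] [IsSepClosed Ω]
    (η : Spec (.of Ω) ⟶ pullback f g) :
    Function.Surjective ((Pi1.map (pullback.fst f g) η).prod (Pi1.map (pullback.snd f g) η)) := by
  rintro ⟨σ, τ⟩
  let Z : FEt U ⊕ FEt V → Set (Pi1 η) := Sum.elim
    (fun Y ↦ {α | (Pi1.map (pullback.fst f g) η α).hom.app Y = σ.hom.app Y})
    (fun Y ↦ {α | (Pi1.map (pullback.snd f g) η α).hom.app Y = τ.hom.app Y})
  have hZ : ∀ i, IsClosed (Z i) := Sum.rec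
    (fun Y ↦ Pi1.isClosed_setOf_map_app_eq _ _ Y _) (fun Y ↦ Pi1.isClosed_setOf_map_app_eq _ _ Y _)
  have hfin (I : Finset (FEt U ⊕ FEt V)) : (⋂ i ∈ I, Z i).Nonempty := by
    obtain ⟨α, hU, hV⟩ := Pi1.exists_map_app_eq σ τ
      (I.finite_toSet.preimage Sum.inl_injective.injOn)
      (I.finite_toSet.preimage Sum.inr_injective.injOn)
    exact ⟨α, Set.mem_iInter₂.mpr (Sum.rec hU hV)⟩
  obtain ⟨α, hα⟩ := CompactSpace.iInter_nonempty hZ hfin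
  rw [Set.mem_iInter] at hα
  refine ⟨α, Prod.ext ?_ ?_⟩
  · ext Y : 3
    exact hα (.inl Y)
  · ext Y : 3
    exact hα (.inr Y)

theorem lemma5p1 {F : Type*} [Field F] [Finite F] {k : Type u} [Field k] [Algebra F k]
    [IsAlgClosure F k] {U V : Scheme.{u}} (f : U ⟶ Spec (.of k)) (g : V ⟶ Spec (.of k))
    [IsAffine U] [IsAffine V] [ConnectedSpace U] [ConnectedSpace V] [Smooth f] [Smooth g]
    {Ω : Type u} [Field Ω] [IsSepClosed Ω] (η : Spec (.of Ω) ⟶ pullback f g) :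
    Function.Surjective
      ((EtalePi.Pi1.map (pullback.fst f g) η).prod (EtalePi.Pi1.map (pullback.snd f g) η) :
        EtalePi.Pi1 η →* EtalePi.Pi1 (η ≫ pullback.fst f g) ×
          EtalePi.Pi1 (η ≫ pullback.snd f g)) := by
  have : IsAlgClosed k := IsAlgClosure.isAlgClosed F
  have : IsLocallyNoetherian V := LocallyOfFiniteType.isLocallyNoetherian g
  exact lemma5p1_general f g η
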